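/- Let $k$ be a commutative artinian ring, let $\check k$ be the minimal injective cogenerator of the category of finitely generated $k$-modules, and write $D=\operatorname{Hom}_k(-,\check k)$. Let $(\mathcal C,\mathbb E,\mathfrak s)$ be a $k$-linear, Krull–Schmidt, Ext-finite extriangulated category (Ext-finite: $\mathbb E(A,B)$ is a finitely generated $k$-module for all $A,B$). A morphism $f$ is $\mathfrak s$-projective if $\mathbb E(f,A)=0$ for all objects $A$, and $\mathfrak s$-injective if $\mathbb E(A,f)=0$ for all $A$; let $\mathcal P(C,Y)\subseteq\mathcal C(C,Y)$ be the set of $\mathfrak s$-projective morphisms, and let $\overline{\mathcal C}$ be the quotient of $\mathcal C$ by the ideal of $\mathfrak s$-injective morphisms. Let $\mathcal C_r$ be the full subcategory of those $C\in\mathcal C$ for which the contravariant functor $D\mathbb E(C,-)$ from $\overline{\mathcal C}$ to $k$-modules is representable, and for $C\in\mathcal C_r$ let $\tau C$ be any object with a natural isomorphism $\overline{\mathcal C}(-,\tau C)\cong D\mathbb E(C,-)$. For an object $T$, let $\operatorname{add}(T)$ be the class of direct summands of finite direct sums of copies of $T$. A morphism $\alpha\colon X\to Y$ is right $C$-determined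 if every $g\colon T\to Y$, such that $g\circ h$ factors through $\alpha$ for all $h\colon C\to T$, itself factors through $\alpha$. **Theorem.** Let $C\in\mathcal C_r$ and $Y\in\mathcal C$, and let $H$ be a right $\operatorname{End}_{\mathcal C}(C)$-submodule of $\mathcal C(C,Y)$ with $\mathcal P(C,Y)\subseteq H$. Then there is an $\mathfrak s$-triangle $$K\longrightarrow X\stackrel{\alpha}{\longrightarrow}Y\stackrel{\eta}{\dashrightarrow}$$ such that $\alpha$ is right $C$-determined, $K\in\operatorname{add}(\tau C)$, and $H=\operatorname{Im}\mathcal C(C,\alpha)=\{\alpha\circ g\mid g\in\mathcal C(C,X)\}$. -/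

import Mathlib

open CategoryTheory CategoryTheory.Limits Opposite

universe v u w r

namespace ExtriangulatedAR

section Bifunctor

/-- The group `𝔼(Z, A)` of `𝔼`-extensions, for `𝔼 : 𝒞ᵒᵖ × 𝒞 → Ab`. -/
abbrev ExtObj {𝒞 : Type u} [Category.{v} 𝒞] (E : 𝒞ᵒᵖ ⥤ 𝒞 ⥤ AddCommGrpCat.{w})
    (Z A : 𝒞) : Type w := (E.obj (op Z)).obj A

/-- `a_⋆ δ = 𝔼(Z, a)(δ)`. -/
def push {𝒞 : Type u} [Category.{v} 𝒞] (E : 𝒞ᵒᵖ ⥤ 𝒞 ⥤ AddCommGrpCat.{w})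
    {Z A A' : 𝒞} (a : A ⟶ A') : ExtObj E Z A →+ ExtObj E Z A' :=
  ((E.obj (op Z)).map a).hom

/-- `c^⋆ δ = 𝔼(c, A)(δ)`. -/
def pull {𝒞 : Type u} [Category.{v} 𝒞] (E : 𝒞ᵒᵖ ⥤ 𝒞 ⥤ AddCommGrpCat.{w})
    {Z Z' A : 𝒞} (c : Z' ⟶ Z) : ExtObj E Z A →+ ExtObj E Z' A :=
  ((E.map c.op).app A).hom

/-- The element `δ ⊕ δ'` of `𝔼(Z ⊕ Z', A ⊕ A')` with components `(δ, 0, 0, δ')`. -/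
noncomputable def sumExt {𝒞 : Type u} [Category.{v} 𝒞] [Preadditive 𝒞] [HasBinaryBiproducts 𝒞]
    (E : 𝒞ᵒᵖ ⥤ 𝒞 ⥤ AddCommGrpCat.{w}) {Z A Z' A' : 𝒞}
    (δ : ExtObj E Z A) (δ' : ExtObj E Z' A') : ExtObj E (Z ⊞ Z') (A ⊞ A') :=
  push E (biprod.inl : A ⟶ A ⊞ A') (pull E (biprod.fst : Z ⊞ Z' ⟶ Z) δ) +
    push E (biprod.inr : A' ⟶ A ⊞ A') (pull E (biprod.snd : Z ⊞ Z' ⟶ Z') δ')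

end Bifunctor

section Sequences

/-- A sequence of morphisms `A ⟶ mid ⟶ Z`. -/
structure Seq {𝒞 : Type u} [Category.{v} 𝒞] (A Z : 𝒞) where
  mid : 𝒞
  fst : A ⟶ mid
  snd : mid ⟶ Z

/-- Equivalence of sequences: an isomorphism of the middle terms, compatible with the identities
of the end terms. -/
def Seq.Equiv {𝒞 : Type u} [Category.{v} 𝒞] {A Z : 𝒞} (S S' : Seq A Z) : Prop :=
  ∃ b : S.mid ≅ S'.mid, S.fst ≫ b.hom = S'.fst ∧ b.hom ≫ S'.snd = S.snd

instance seqSetoid {𝒞 : Type u} [Category.{v} 𝒞] (A Z : 𝒞) : Setoid (Seq A Z) where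
  r := Seq.Equiv
  iseqv :=
    { refl := fun S => ⟨Iso.refl _, by simp, by simp⟩
      symm := by
        rintro S S' ⟨b, h₁, h₂⟩
        exact ⟨b.symm, by simp [← h₁], by simp [← h₂]⟩
      trans := by
        rintro S S' S'' ⟨b, h₁, h₂⟩ ⟨b', h₁', h₂'⟩
        exact ⟨b ≪≫ b', by simp [← h₁', ← h₁], by simp [← h₂, ← h₂']⟩ }

/-- Equivalence classes `[A ⟶ B ⟶ Z]`. -/
abbrev SeqClass {𝒞 : Type u} [Category.{v} 𝒞] (A Z : 𝒞) : Type (max u v) :=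
  Quotient (seqSetoid A Z)

/-- The class `[A -x→ B -y→ Z]`. -/
abbrev seqClass {𝒞 : Type u} [Category.{v} 𝒞] {A B Z : 𝒞} (x : A ⟶ B) (y : B ⟶ Z) :
    SeqClass A Z :=
  Quotient.mk (seqSetoid A Z) ⟨B, x, y⟩

end Sequences

/-- An extriangulated category in the sense of Nakaoka and Palu: the structure `(𝔼, 𝔰)` on an
additive category `𝒞`, satisfying (ET1)-(ET4), (ET3)ᵒᵖ, (ET4)ᵒᵖ. -/
structure Extriangulated (𝒞 : Type u) [Category.{v} 𝒞] [Preadditive 𝒞] [HasZeroObject 𝒞]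
    [HasBinaryBiproducts 𝒞] where
  /-- (ET1) the bifunctor `𝔼`, which is additive in both variables. -/
  E : 𝒞ᵒᵖ ⥤ 𝒞 ⥤ AddCommGrpCat.{w}
  additive_left : E.Additive
  additive_right : ∀ Z : 𝒞ᵒᵖ, (E.obj Z).Additive
  /-- (ET2) the correspondence `𝔰`, which is an additive realization. -/
  s : ∀ {Z A : 𝒞}, ExtObj E Z A → SeqClass A Z
  realization : ∀ {A B Z A' B' Z' : 𝒞} (δ : ExtObj E Z A) (δ' : ExtObj E Z' A')
    (x : A ⟶ B) (y : B ⟶ Z) (x' : A' ⟶ B') (y' : B' ⟶ Z'),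
    s δ = seqClass x y → s δ' = seqClass x' y' →
    ∀ (a : A ⟶ A') (c : Z ⟶ Z'), push E a δ = pull E c δ' →
      ∃ b : B ⟶ B', x ≫ b = a ≫ x' ∧ y ≫ c = b ≫ y'
  s_zero : ∀ Z A : 𝒞, s (0 : ExtObj E Z A) =
    seqClass (biprod.inl : A ⟶ A ⊞ Z) (biprod.snd : A ⊞ Z ⟶ Z)
  s_sum : ∀ {A B Z A' B' Z' : 𝒞} (δ : ExtObj E Z A) (δ' : ExtObj E Z' A')
    (x : A ⟶ B) (y : B ⟶ Z) (x' : A' ⟶ B') (y' : B' ⟶ Z'),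
    s δ = seqClass x y → s δ' = seqClass x' y' →
      s (sumExt E δ δ') = seqClass (biprod.map x x') (biprod.map y y')
  et3 : ∀ {A B Z A' B' Z' : 𝒞} (δ : ExtObj E Z A) (δ' : ExtObj E Z' A')
    (x : A ⟶ B) (y : B ⟶ Z) (x' : A' ⟶ B') (y' : B' ⟶ Z'),
    s δ = seqClass x y → s δ' = seqClass x' y' →
    ∀ (a : A ⟶ A') (b : B ⟶ B'), x ≫ b = a ≫ x' →
      ∃ c : Z ⟶ Z', y ≫ c = b ≫ y' ∧ push E a δ = pull E c δ'
  et3_op : ∀ {A B Z A' B' Z' : 𝒞} (δ : ExtObj E Z A) (δ' : ExtObj E Z' A')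
    (x : A ⟶ B) (y : B ⟶ Z) (x' : A' ⟶ B') (y' : B' ⟶ Z'),
    s δ = seqClass x y → s δ' = seqClass x' y' →
    ∀ (b : B ⟶ B') (c : Z ⟶ Z'), y ≫ c = b ≫ y' →
      ∃ a : A ⟶ A', x ≫ b = a ≫ x' ∧ push E a δ = pull E c δ'
  et4 : ∀ {A B Z D F : 𝒞} (δ : ExtObj E Z A) (ρ : ExtObj E F B)
    (x : A ⟶ B) (y : B ⟶ Z) (p : B ⟶ D) (q : D ⟶ F),
    s δ = seqClass x y → s ρ = seqClass p q →
    ∃ (G : 𝒞) (ξ : ExtObj E G A) (z : A ⟶ D) (t : D ⟶ G) (m : Z ⟶ G) (n : G ⟶ F),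
      s ξ = seqClass z t ∧ x ≫ p = z ∧ y ≫ m = p ≫ t ∧ t ≫ n = q ∧
      s (push E y ρ) = seqClass m n ∧ pull E m ξ = δ ∧ push E x ξ = pull E n ρ
  et4_op : ∀ {A B Z D F : 𝒞} (δ : ExtObj E A Z) (ρ : ExtObj E B F)
    (y : Z ⟶ B) (x : B ⟶ A) (q : F ⟶ D) (p : D ⟶ B),
    s δ = seqClass y x → s ρ = seqClass q p →
    ∃ (G : 𝒞) (ξ : ExtObj E A G) (t : G ⟶ D) (z : D ⟶ A) (n : F ⟶ G) (m : G ⟶ Z),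
      s ξ = seqClass t z ∧ p ≫ x = z ∧ m ≫ y = t ≫ p ∧ n ≫ t = q ∧
      s (pull E y ρ) = seqClass n m ∧ push E m ξ = δ ∧ pull E x ξ = push E n ρ

section Notions

/-- The extension group `𝔼(Z, A)` of an extriangulated category. -/
abbrev Extriangulated.Ext {𝒞 : Type u} [Category.{v} 𝒞] [Preadditive 𝒞] [HasZeroObject 𝒞]
    [HasBinaryBiproducts 𝒞] (𝓔 : Extriangulated.{v, u, w} 𝒞) (Z A : 𝒞) : Type w :=
  ExtObj 𝓔.E Z A

/-- `A -x→ B -y→ Z ⇢δ` is an `𝔰`-triangle (so `x` is an `𝔰`-inflation, `y` an `𝔰`-deflation). -/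
def Extriangulated.IsTriangle {𝒞 : Type u} [Category.{v} 𝒞] [Preadditive 𝒞] [HasZeroObject 𝒞]
    [HasBinaryBiproducts 𝒞] (𝓔 : Extriangulated.{v, u, w} 𝒞) {A B Z : 𝒞}
    (x : A ⟶ B) (y : B ⟶ Z) (δ : 𝓔.Ext Z A) : Prop :=
  𝓔.s δ = seqClass x y

/-- `f : Z' ⟶ Z` is an `𝔰`-projective morphism: `𝔼(f, A) = 0` for all `A`. -/
def Extriangulated.IsProjMor {𝒞 : Type u} [Category.{v} 𝒞] [Preadditive 𝒞] [HasZeroObject 𝒞]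
    [HasBinaryBiproducts 𝒞] (𝓔 : Extriangulated.{v, u, w} 𝒞) {Z' Z : 𝒞} (f : Z' ⟶ Z) : Prop :=
  ∀ (A : 𝒞) (δ : 𝓔.Ext Z A), pull 𝓔.E f δ = 0

/-- `f : A ⟶ A'` is an `𝔰`-injective morphism: `𝔼(Z, f) = 0` for all `Z`. -/
def Extriangulated.IsInjMor {𝒞 : Type u} [Category.{v} 𝒞] [Preadditive 𝒞] [HasZeroObject 𝒞]
    [HasBinaryBiproducts 𝒞] (𝓔 : Extriangulated.{v, u, w} 𝒞) {A A' : 𝒞} (f : A ⟶ A') : Prop :=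
  ∀ (Z : 𝒞) (δ : 𝓔.Ext Z A), push 𝓔.E f δ = 0

/-- `k`-linearity of the extriangulated category: `𝒞` is `k`-linear and the composition
`𝒞(A, B) × 𝔼(B, Z) × 𝒞(Z, D) → 𝔼(A, D)` is `k`-linear in each argument. (Additivity is part of
the extriangulated structure.) -/
class Extriangulated.IsLinear (k : Type r) [CommRing k] {𝒞 : Type u} [Category.{v} 𝒞]
    [Preadditive 𝒞] [HasZeroObject 𝒞] [HasBinaryBiproducts 𝒞] [Linear k 𝒞]
    (𝓔 : Extriangulated.{v, u, w} 𝒞) [∀ Z A : 𝒞, Module k (𝓔.Ext Z A)] : Prop where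
  push_smul : ∀ {Z A A' : 𝒞} (a : A ⟶ A') (t : k) (δ : 𝓔.Ext Z A),
    push 𝓔.E a (t • δ) = t • push 𝓔.E a δ
  pull_smul : ∀ {Z Z' A : 𝒞} (c : Z' ⟶ Z) (t : k) (δ : 𝓔.Ext Z A),
    pull 𝓔.E c (t • δ) = t • pull 𝓔.E c δ
  smul_push : ∀ {Z A A' : 𝒞} (a : A ⟶ A') (t : k) (δ : 𝓔.Ext Z A),
    push 𝓔.E (t • a) δ = t • push 𝓔.E a δ
  smul_pull : ∀ {Z Z' A : 𝒞} (c : Z' ⟶ Z) (t : k) (δ : 𝓔.Ext Z A),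
    pull 𝓔.E (t • c) δ = t • pull 𝓔.E c δ

/-- Krull-Schmidt categories: every object is a finite direct sum of objects with local
endomorphism rings. -/
def IsKrullSchmidt (𝒞 : Type u) [Category.{v} 𝒞] [Preadditive 𝒞] [HasFiniteBiproducts 𝒞] : Prop :=
  ∀ X : 𝒞, ∃ (n : ℕ) (F : Fin n → 𝒞),
    (∀ i, IsLocalRing (CategoryTheory.End (F i))) ∧ Nonempty (X ≅ ⨁ F)

/-- `f : X ⟶ Y` is right `C`-determined. -/
def IsRightDetermined {𝒞 : Type u} [Category.{v} 𝒞] {X Y : 𝒞} (f : X ⟶ Y) (C : 𝒞) : Prop :=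
  ∀ (T : 𝒞) (g : T ⟶ Y), (∀ h : C ⟶ T, ∃ p : C ⟶ X, p ≫ f = h ≫ g) → ∃ p : T ⟶ X, p ≫ f = g

/-- `K ∈ add T`: `K` is a direct summand of a finite direct sum of copies of `T`. -/
def InAdd {𝒞 : Type u} [Category.{v} 𝒞] [Preadditive 𝒞] [HasFiniteBiproducts 𝒞]
    [HasBinaryBiproducts 𝒞] (T K : 𝒞) : Prop :=
  ∃ (n : ℕ) (L : 𝒞), Nonempty (K ⊞ L ≅ ⨁ fun _ : Fin n => T)

end Notions

section Duality

/-- `J` is an injective cogenerator for the category `k`-mod of finitely generated `k`-modules. -/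
structure IsInjectiveCogenerator (k : Type r) [CommRing k] (J : Type r) [AddCommGroup J]
    [Module k J] : Prop where
  finite : Module.Finite k J
  extend : ∀ (M N : Type r) [AddCommGroup M] [Module k M] [Module.Finite k M]
    [AddCommGroup N] [Module k N] [Module.Finite k N] (i : M →ₗ[k] N),
    Function.Injective i → ∀ g : M →ₗ[k] J, ∃ h : N →ₗ[k] J, h.comp i = g
  cogenerate : ∀ (M : Type r) [AddCommGroup M] [Module k M] [Module.Finite k M] (m : M),
    m ≠ 0 → ∃ f : M →ₗ[k] J, f m ≠ 0

/-- `J` is a minimal injective cogenerator for `k`-mod: no proper submodule of `J` is again an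
injective cogenerator. -/
structure IsMinimalInjectiveCogenerator (k : Type r) [CommRing k] (J : Type r) [AddCommGroup J]
    [Module k J] : Prop extends IsInjectiveCogenerator k J where
  minimal : ∀ N : Submodule k J, IsInjectiveCogenerator k N → N = ⊤

end Duality

section Tau

/-- `𝔼(Z, a)` as a `k`-linear map. -/
def Extriangulated.pushₗ (k : Type r) [CommRing k] {𝒞 : Type u} [Category.{v} 𝒞]
    [Preadditive 𝒞] [HasZeroObject 𝒞] [HasBinaryBiproducts 𝒞] [Linear k 𝒞]
    (𝓔 : Extriangulated.{v, u, w} 𝒞) [∀ Z A : 𝒞, Module k (𝓔.Ext Z A)] [𝓔.IsLinear k]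
    (Z : 𝒞) {A A' : 𝒞} (a : A ⟶ A') : 𝓔.Ext Z A →ₗ[k] 𝓔.Ext Z A' where
  toFun := push 𝓔.E a
  map_add' := map_add _
  map_smul' := fun t δ => IsLinear.push_smul a t δ

/-- The `k`-submodule `ℐ(A, A')` of `𝔰`-injective morphisms in `𝒞(A, A')`. -/
def Extriangulated.injMor (k : Type r) [CommRing k] {𝒞 : Type u} [Category.{v} 𝒞]
    [Preadditive 𝒞] [HasZeroObject 𝒞] [HasBinaryBiproducts 𝒞] [Linear k 𝒞]
    (𝓔 : Extriangulated.{v, u, w} 𝒞) [∀ Z A : 𝒞, Module k (𝓔.Ext Z A)] [𝓔.IsLinear k]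
    (A A' : 𝒞) : Submodule k (A ⟶ A') where
  carrier := {f | 𝓔.IsInjMor f}
  add_mem' := by
    intro f g hf hg Z δ
    have := 𝓔.additive_right (op Z)
    have h : push 𝓔.E (Z := Z) (f + g) δ = push 𝓔.E f δ + push 𝓔.E g δ := by
      simp [push, Functor.map_add]
    rw [h, hf Z δ, hg Z δ, add_zero]
  zero_mem' := by
    intro Z δ
    have := 𝓔.additive_right (op Z)
    simp [push, Functor.map_zero]
  smul_mem' := by
    intro t f hf Z δ
    rw [IsLinear.smul_push, hf Z δ, smul_zero]

/-- The morphisms `A ⟶ A'` of the costable category `𝒞/ℐ`. -/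
abbrev Extriangulated.CostableHom (k : Type r) [CommRing k] {𝒞 : Type u} [Category.{v} 𝒞]
    [Preadditive 𝒞] [HasZeroObject 𝒞] [HasBinaryBiproducts 𝒞] [Linear k 𝒞]
    (𝓔 : Extriangulated.{v, u, w} 𝒞) [∀ Z A : 𝒞, Module k (𝓔.Ext Z A)] [𝓔.IsLinear k]
    (A A' : 𝒞) : Type v :=
  (A ⟶ A') ⧸ 𝓔.injMor k A A'

/-- Precomposition with (the class of) `f` in the costable category. -/
def Extriangulated.costablePrecomp (k : Type r) [CommRing k] {𝒞 : Type u} [Category.{v} 𝒞]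
    [Preadditive 𝒞] [HasZeroObject 𝒞] [HasBinaryBiproducts 𝒞] [Linear k 𝒞]
    (𝓔 : Extriangulated.{v, u, w} 𝒞) [∀ Z A : 𝒞, Module k (𝓔.Ext Z A)] [𝓔.IsLinear k]
    {M N : 𝒞} (f : M ⟶ N) (T : 𝒞) : 𝓔.CostableHom k N T →ₗ[k] 𝓔.CostableHom k M T :=
  Submodule.mapQ _ _ (Linear.leftComp k T f) (by
    intro g hg Z δ
    have h : push 𝓔.E (Z := Z) (f ≫ g) δ = push 𝓔.E g (push 𝓔.E f δ) := by
      simp [push, Functor.map_comp]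
    exact h.trans (hg Z _))

/-- An isomorphism `𝒞/ℐ(-, T) ≅ D𝔼(C, -)` of contravariant functors from the costable category to
`k`-modules, where `D = Hom_k(-, J)`. -/
structure Extriangulated.TauIso (k : Type r) [CommRing k] (J : Type r) [AddCommGroup J]
    [Module k J] {𝒞 : Type u} [Category.{v} 𝒞]
    [Preadditive 𝒞] [HasZeroObject 𝒞] [HasBinaryBiproducts 𝒞] [Linear k 𝒞]
    (𝓔 : Extriangulated.{v, u, w} 𝒞) [∀ Z A : 𝒞, Module k (𝓔.Ext Z A)] [𝓔.IsLinear k]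
    (C T : 𝒞) where
  equiv : ∀ M : 𝒞, 𝓔.CostableHom k M T ≃ₗ[k] (𝓔.Ext C M →ₗ[k] J)
  natural : ∀ {M N : 𝒞} (f : M ⟶ N) (g : 𝓔.CostableHom k N T),
    equiv M (𝓔.costablePrecomp k f T g) = (equiv N g).comp (𝓔.pushₗ k C f)

/-- `T` is a choice of `τC`. -/
def Extriangulated.IsTau (k : Type r) [CommRing k] (J : Type r) [AddCommGroup J]
    [Module k J] {𝒞 : Type u} [Category.{v} 𝒞]
    [Preadditive 𝒞] [HasZeroObject 𝒞] [HasBinaryBiproducts 𝒞] [Linear k 𝒞]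
    (𝓔 : Extriangulated.{v, u, w} 𝒞) [∀ Z A : 𝒞, Module k (𝓔.Ext Z A)] [𝓔.IsLinear k]
    (C T : 𝒞) : Prop :=
  Nonempty (𝓔.TauIso k J C T)

/-- `C ∈ 𝒞_r`: the functor `D𝔼(C, -)` on the costable category is representable. -/
def Extriangulated.InCr (k : Type r) [CommRing k] (J : Type r) [AddCommGroup J]
    [Module k J] {𝒞 : Type u} [Category.{v} 𝒞]
    [Preadditive 𝒞] [HasZeroObject 𝒞] [HasBinaryBiproducts 𝒞] [Linear k 𝒞]
    (𝓔 : Extriangulated.{v, u, w} 𝒞) [∀ Z A : 𝒞, Module k (𝓔.Ext Z A)] [𝓔.IsLinear k]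
    (C : 𝒞) : Prop :=
  ∃ T : 𝒞, 𝓔.IsTau k J C T

end Tau

end ExtriangulatedAR

open ExtriangulatedAR

/-!
The argument rests on a pairing `𝒞(C, Y) × 𝔼(Y, τC) ⟶ J`, `(h, θ) ↦ ψ(h^⋆ θ)`, where
`ψ : 𝔼(C, τC) ⟶ J` is the functional that corresponds to the identity of `τC`
(`Extriangulated.TauIso.trace`). By the Yoneda lemma, every functional on `𝔼(C, M)` is `ψ ∘ f_⋆`
for some `f : M ⟶ τC`.

The pairing is non-degenerate in `θ` (`eq_zero_of_trace_pull_eq_zero`): if `θ` pairs to zero with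
all morphisms, then by the exact sequence `𝒞(C, Z) ⟶ 𝔼(C, τC) ⟶ 𝔼(C, B)` of a realization
`τC ⟶ B ⟶ Z` the functional `ψ` extends to `𝔼(C, B)`, so the inflation `τC ⟶ B` splits up to an
`𝔰`-injective morphism and `θ = 0`. It is non-degenerate in `h` modulo `𝔰`-projective morphisms
(`isProjMor_of_trace_pull_eq_zero`). Since `𝔼(Y, τC)` is finitely generated and `J` is injective,
every functional on `𝒞(C, Y)` that kills the `𝔰`-projective morphisms is the pairing with some `θ`
(`exists_eq_trace_pull`). Hence `H` is the set of all `h` with `h^⋆ θ = 0` for all `θ` in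
`Θ = {θ ∈ 𝔼(Y, τC) | h^⋆ θ = 0 for all h ∈ H}` (`mem_iff_forall_pull_eq_zero`).

Finitely many generators of `Θ` are the components of an extension `η` of `Y` by a finite direct sum
of copies of `τC`. A realization of `η` is the required triangle: a morphism `g` factors through
`α` iff `g^⋆ η = 0`, which gives the image of `𝒞(C, α)`, and non-degeneracy in `θ` shows that
`g^⋆ η = 0` can be tested after precomposition with morphisms from `C`.
-/

namespace ExtriangulatedAR

/-! ### Functoriality of `𝔼` and exact sequences of an `𝔰`-triangle -/

section Bifunctor

variable {𝒞 : Type u} [Category.{v} 𝒞] (E : 𝒞ᵒᵖ ⥤ 𝒞 ⥤ AddCommGrpCat.{w})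

lemma push_id {Z A : 𝒞} (δ : ExtObj E Z A) : push E (𝟙 A) δ = δ := by
  simp [push]

lemma push_comp {Z A A' A'' : 𝒞} (a : A ⟶ A') (a' : A' ⟶ A'') (δ : ExtObj E Z A) :
    push E (a ≫ a') δ = push E a' (push E a δ) := by
  simp [push]

lemma pull_comp {Z Z' Z'' A : 𝒞} (c : Z' ⟶ Z) (c' : Z'' ⟶ Z') (δ : ExtObj E Z A) :
    pull E (c' ≫ c) δ = pull E c' (pull E c δ) := by
  simp [pull]

lemma push_pull {Z Z' A A' : 𝒞} (a : A ⟶ A') (c : Z' ⟶ Z) (δ : ExtObj E Z A) :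
    push E a (pull E c δ) = pull E c (push E a δ) :=
  (ConcreteCategory.congr_hom ((E.map c.op).naturality a) δ).symm

end Bifunctor

namespace Extriangulated

section Exactness

variable {𝒞 : Type u} [Category.{v} 𝒞] [Preadditive 𝒞] [HasZeroObject 𝒞]
  [HasBinaryBiproducts 𝒞] (𝓔 : Extriangulated.{v, u, w} 𝒞)

lemma push_add_hom {Z A A' : 𝒞} (a b : A ⟶ A') (δ : 𝓔.Ext Z A) :
    push 𝓔.E (a + b) δ = push 𝓔.E a δ + push 𝓔.E b δ := by
  have := 𝓔.additive_right (op Z)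
  simp [push, Functor.map_add]

lemma push_zero_hom {Z A A' : 𝒞} (δ : 𝓔.Ext Z A) :
    push 𝓔.E (0 : A ⟶ A') δ = 0 := by
  have := 𝓔.additive_right (op Z)
  simp [push, Functor.map_zero]

lemma pull_add_hom {Z Z' A : 𝒞} (c d : Z' ⟶ Z) (δ : 𝓔.Ext Z A) :
    pull 𝓔.E (c + d) δ = pull 𝓔.E c δ + pull 𝓔.E d δ := by
  have := 𝓔.additive_left
  simp [pull, Functor.map_add]

lemma exists_isTriangle {Z A : 𝒞} (δ : 𝓔.Ext Z A) :
    ∃ (B : 𝒞) (x : A ⟶ B) (y : B ⟶ Z), 𝓔.IsTriangle x y δ := by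
  obtain ⟨⟨B, x, y⟩, h⟩ := Quotient.exists_rep (𝓔.s δ)
  exact ⟨B, x, y, h.symm⟩

variable {𝓔} {A B Z : 𝒞} {x : A ⟶ B} {y : B ⟶ Z} {δ : 𝓔.Ext Z A}

/-- Exactness of `𝒞(C, B) ⟶ 𝒞(C, Z) ⟶ 𝔼(C, A)`: both directions compare the triangle with the
split one on `A` and `C`. -/
lemma IsTriangle.factors_iff (h : 𝓔.IsTriangle x y δ) {C : 𝒞} (c : C ⟶ Z) :
    (∃ p : C ⟶ B, p ≫ y = c) ↔ pull 𝓔.E c δ = 0 := by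
  constructor
  · rintro ⟨p, rfl⟩
    obtain ⟨c', hc', hδ⟩ := 𝓔.et3 _ δ _ _ x y (𝓔.s_zero C A) h (𝟙 A) (biprod.desc x p) (by simp)
    have : c' = p ≫ y := by
      simpa using congrArg (fun f => biprod.inr ≫ f) hc'
    rw [← this, ← hδ, map_zero]
  · intro h0
    obtain ⟨b, -, hb⟩ := 𝓔.realization _ δ _ _ x y (𝓔.s_zero C A) h (𝟙 A) c (by simp [h0])
    exact ⟨biprod.inr ≫ b, by simp [Category.assoc, ← hb]⟩

lemma IsTriangle.push_fst (h : 𝓔.IsTriangle x y δ) : push 𝓔.E x δ = 0 := by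
  obtain ⟨c, -, hc⟩ := 𝓔.et3 δ _ x y _ _ h (𝓔.s_zero Z B) x biprod.inl rfl
  rw [hc, map_zero]

/-- Exactness of `𝒞(C, Z) ⟶ 𝔼(C, A) ⟶ 𝔼(C, B)`. -/
lemma IsTriangle.exists_pull_eq (h : 𝓔.IsTriangle x y δ) {C : 𝒞} (ε : 𝓔.Ext C A)
    (hε : push 𝓔.E x ε = 0) : ∃ c : C ⟶ Z, pull 𝓔.E c δ = ε := by
  obtain ⟨B', x', y', h'⟩ := 𝓔.exists_isTriangle ε
  -- Since `x_⋆ ε = 0`, the morphism `x` extends along `x'`.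
  obtain ⟨b, hb, -⟩ := 𝓔.realization ε 0 x' y' _ _ h' (𝓔.s_zero C B) x (𝟙 C) (by simp [hε])
  obtain ⟨c, -, hc⟩ := 𝓔.et3 ε δ x' y' x y h' h (𝟙 A) (b ≫ biprod.fst)
    (by rw [← Category.assoc, hb]; simp)
  exact ⟨c, by rw [← hc, push_id]⟩

end Exactness

end Extriangulated

/-! ### Injective cogenerators and finitely generated modules in arbitrary universes -/

section Duality

variable {k : Type r} [CommRing k] {J : Type r} [AddCommGroup J] [Module k J]

lemma IsInjectiveCogenerator.exists_comp_eq (hJ : IsInjectiveCogenerator k J) {M N : Type*}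
    [AddCommGroup M] [Module k M] [Module.Finite k M]
    [AddCommGroup N] [Module k N] [Module.Finite k N] (i : M →ₗ[k] N)
    (hi : Function.Injective i) (g : M →ₗ[k] J) : ∃ h : N →ₗ[k] J, h.comp i = g := by
  obtain ⟨m, PM, ⟨eM⟩⟩ := Module.Finite.exists_fin_quot_equiv k M
  obtain ⟨n, PN, ⟨eN⟩⟩ := Module.Finite.exists_fin_quot_equiv k N
  obtain ⟨h, hh⟩ := hJ.extend _ _ (eN.symm.toLinearMap ∘ₗ i ∘ₗ eM.toLinearMap)
    (eN.symm.injective.comp (hi.comp eM.injective)) (g ∘ₗ eM.toLinearMap)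
  refine ⟨h ∘ₗ eN.symm.toLinearMap, ?_⟩
  ext x
  simpa using LinearMap.congr_fun hh (eM.symm x)

lemma IsInjectiveCogenerator.exists_ne_zero (hJ : IsInjectiveCogenerator k J) {M : Type*}
    [AddCommGroup M] [Module k M] [Module.Finite k M] {m : M} (hm : m ≠ 0) :
    ∃ f : M →ₗ[k] J, f m ≠ 0 := by
  obtain ⟨n, P, ⟨e⟩⟩ := Module.Finite.exists_fin_quot_equiv k M
  obtain ⟨f, hf⟩ := hJ.cogenerate _ (e.symm m) (by simpa using hm)
  exact ⟨f ∘ₗ e.symm.toLinearMap, hf⟩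

/-- A functional that vanishes on the kernel of a linear map into a finitely generated module
factors through that map. -/
lemma IsInjectiveCogenerator.exists_comp_eq_of_ker_le [IsNoetherianRing k]
    (hJ : IsInjectiveCogenerator k J) {M N : Type*} [AddCommGroup M] [Module k M]
    [AddCommGroup N] [Module k N] [Module.Finite k N] (f : M →ₗ[k] N) (g : M →ₗ[k] J)
    (hfg : LinearMap.ker f ≤ LinearMap.ker g) : ∃ h : N →ₗ[k] J, h.comp f = g := by
  obtain ⟨h, hh⟩ := hJ.exists_comp_eq (LinearMap.range f).subtype (Submodule.subtype_injective _)
    (((LinearMap.ker f).liftQ g hfg) ∘ₗ f.quotKerEquivRange.symm.toLinearMap)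
  refine ⟨h, LinearMap.ext fun x => ?_⟩
  have := LinearMap.congr_fun hh (f.quotKerEquivRange (Submodule.Quotient.mk x))
  simpa using this

end Duality

/-! ### The pairing between `𝒞(C, Y)` and `𝔼(Y, τC)` -/

namespace Extriangulated

variable {k : Type r} [CommRing k] {J : Type r} [AddCommGroup J] [Module k J]
  {𝒞 : Type u} [Category.{v} 𝒞] [Preadditive 𝒞] [HasZeroObject 𝒞] [HasBinaryBiproducts 𝒞]
  [Linear k 𝒞] {𝓔 : Extriangulated.{v, u, w} 𝒞} [∀ Z A : 𝒞, Module k (𝓔.Ext Z A)]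
  [𝓔.IsLinear k]

variable (k 𝓔) in
/-- The connecting map `𝒞(C, Y) ⟶ 𝔼(C, A)`, `h ↦ h^⋆ θ`, of an extension `θ ∈ 𝔼(Y, A)`. -/
def connecting (C : 𝒞) {Y A : 𝒞} (θ : 𝓔.Ext Y A) : (C ⟶ Y) →ₗ[k] 𝓔.Ext C A where
  toFun h := pull 𝓔.E h θ
  map_add' g h := 𝓔.pull_add_hom g h θ
  map_smul' t h := IsLinear.smul_pull h t θ

variable (k 𝓔) in
/-- `𝔼(c, A)` as a `k`-linear map. -/
def pullₗ {Z Z' : 𝒞} (c : Z' ⟶ Z) (A : 𝒞) : 𝓔.Ext Z A →ₗ[k] 𝓔.Ext Z' A where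
  toFun := pull 𝓔.E c
  map_add' := map_add _
  map_smul' t δ := IsLinear.pull_smul c t δ

namespace TauIso

variable {C T : 𝒞} (φ : 𝓔.TauIso k J C T)

/-- The functional on `𝔼(C, τC)` that corresponds to the identity of `τC`, the universal element
of the representation. -/
def trace : 𝓔.Ext C T →ₗ[k] J :=
  φ.equiv T (Submodule.Quotient.mk (𝟙 T))

/-- The Yoneda lemma: the isomorphism is determined by the universal element. -/
lemma equiv_mk {M : 𝒞} (f : M ⟶ T) :
    φ.equiv M (Submodule.Quotient.mk f) = φ.trace ∘ₗ 𝓔.pushₗ k C f := by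
  have h := φ.natural f (Submodule.Quotient.mk (𝟙 T))
  have h' : 𝓔.costablePrecomp k f T (Submodule.Quotient.mk (𝟙 T)) = Submodule.Quotient.mk f := by
    change Submodule.Quotient.mk (f ≫ 𝟙 T) = _
    rw [Category.comp_id]
  rw [h'] at h
  exact h

lemma exists_trace_comp_push {M : 𝒞} (χ : 𝓔.Ext C M →ₗ[k] J) :
    ∃ f : M ⟶ T, ∀ δ, χ δ = φ.trace (push 𝓔.E f δ) := by
  obtain ⟨f, hf⟩ := Submodule.Quotient.mk_surjective _ ((φ.equiv M).symm χ)
  refine ⟨f, fun δ => ?_⟩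
  have : χ = φ.trace ∘ₗ 𝓔.pushₗ k C f := by
    rw [← φ.equiv_mk, hf, LinearEquiv.apply_symm_apply]
  rw [this]
  rfl

/-- Non-degeneracy of the pairing on the side of the extensions. For a realization
`τC -x→ B ⟶ Z` of `θ`, the trace vanishes on the kernel of `𝔼(C, x)`, so it extends to
`𝔼(C, B)`. Hence `𝟙 τC` factors through `x` modulo `𝔰`-injective morphisms, which kill `θ`. -/
lemma eq_zero_of_trace_pull_eq_zero [IsNoetherianRing k] (hJ : IsInjectiveCogenerator k J)
    (hfin : ∀ Z A : 𝒞, Module.Finite k (𝓔.Ext Z A)) {Z : 𝒞} (θ : 𝓔.Ext Z T)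
    (h : ∀ c : C ⟶ Z, φ.trace (pull 𝓔.E c θ) = 0) : θ = 0 := by
  obtain ⟨B, x, y, hθ⟩ := 𝓔.exists_isTriangle θ
  have := hfin C B
  obtain ⟨χ, hχ⟩ := hJ.exists_comp_eq_of_ker_le (𝓔.pushₗ k C x) φ.trace (by
    intro ε hε
    obtain ⟨c, rfl⟩ := hθ.exists_pull_eq ε hε
    exact h c)
  obtain ⟨b, hb⟩ := φ.exists_trace_comp_push χ
  have hinj : 𝓔.IsInjMor (𝟙 T - x ≫ b) := by
    refine (Submodule.Quotient.eq (𝓔.injMor k T T)).mp ((φ.equiv T).injective ?_)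
    rw [equiv_mk, equiv_mk]
    ext ε
    have h₁ : φ.trace ε = χ (push 𝓔.E x ε) := (LinearMap.congr_fun hχ ε).symm
    change φ.trace (push 𝓔.E (𝟙 T) ε) = φ.trace (push 𝓔.E (x ≫ b) ε)
    rw [push_id, push_comp, h₁, hb]
  have h₂ := 𝓔.push_add_hom (𝟙 T - x ≫ b) (x ≫ b) θ
  rwa [sub_add_cancel, push_id, hinj, push_comp, hθ.push_fst, map_zero, add_zero] at h₂

/-- Non-degeneracy of the pairing on the side of the morphisms, modulo the `𝔰`-projective ones:
a functional on `𝔼(C, A)` that detects `h^⋆ δ` is the trace after some `a : A ⟶ τC`, and then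
`a_⋆ δ` pairs non-trivially with `h`. -/
lemma isProjMor_of_trace_pull_eq_zero (hJ : IsInjectiveCogenerator k J)
    (hfin : ∀ Z A : 𝒞, Module.Finite k (𝓔.Ext Z A)) {Y : 𝒞} (h : C ⟶ Y)
    (hh : ∀ θ : 𝓔.Ext Y T, φ.trace (pull 𝓔.E h θ) = 0) : 𝓔.IsProjMor h := by
  intro A δ
  by_contra hδ
  have := hfin C A
  obtain ⟨χ, hχ⟩ := hJ.exists_ne_zero hδ
  obtain ⟨a, ha⟩ := φ.exists_trace_comp_push χ
  exact hχ (by rw [ha, push_pull, hh])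

/-- Pairing with finitely many generators of `𝔼(Y, τC)` embeds `𝒞(C, Y)` modulo `𝔰`-projective
morphisms into a finite power of `J`. -/
lemma exists_generators (hJ : IsInjectiveCogenerator k J)
    (hfin : ∀ Z A : 𝒞, Module.Finite k (𝓔.Ext Z A)) (Y : 𝒞) :
    ∃ (n : ℕ) (θ : Fin n → 𝓔.Ext Y T),
      ∀ h ∈ LinearMap.ker (LinearMap.pi fun i => φ.trace ∘ₗ connecting k 𝓔 C (θ i)),
        𝓔.IsProjMor h := by
  have := hfin Y T
  obtain ⟨n, θ, hθ⟩ := Module.Finite.exists_fin (R := k) (M := 𝓔.Ext Y T)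
  refine ⟨n, θ, fun h hh => φ.isProjMor_of_trace_pull_eq_zero hJ hfin h fun δ => ?_⟩
  have hle : (⊤ : Submodule k (𝓔.Ext Y T)) ≤ LinearMap.ker (φ.trace ∘ₗ pullₗ k 𝓔 h T) := by
    rw [← hθ, Submodule.span_le]
    rintro _ ⟨i, rfl⟩
    exact congrFun hh i
  exact hle Submodule.mem_top

/-- Every functional on `𝒞(C, Y)` that vanishes on the `𝔰`-projective morphisms is the pairing
with an extension: it has the form `∑ sᵢ ∘ ⟨-, θᵢ⟩` with endomorphisms `sᵢ` of `J`, and by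
representability `sᵢ ∘ trace` is the trace after an endomorphism of `τC`, which can be moved
to `θᵢ`. No biduality of `J` is needed for this. -/
lemma exists_eq_trace_pull [IsNoetherianRing k] (hJ : IsInjectiveCogenerator k J)
    (hfin : ∀ Z A : 𝒞, Module.Finite k (𝓔.Ext Z A)) {Y : 𝒞} (χ : (C ⟶ Y) →ₗ[k] J)
    (hχ : ∀ h, 𝓔.IsProjMor h → χ h = 0) :
    ∃ θ : 𝓔.Ext Y T, ∀ h, χ h = φ.trace (pull 𝓔.E h θ) := by
  have := hJ.finite
  obtain ⟨n, θ, hθ⟩ := φ.exists_generators hJ hfin Y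
  obtain ⟨s, hs⟩ := hJ.exists_comp_eq_of_ker_le _ χ fun h hh => hχ h (hθ h hh)
  choose e he using fun i => φ.exists_trace_comp_push
    ((s ∘ₗ LinearMap.single k (fun _ => J) i) ∘ₗ φ.trace)
  refine ⟨∑ i, push 𝓔.E (e i) (θ i), fun h => ?_⟩
  rw [← hs, map_sum, map_sum, LinearMap.comp_apply,
    ← Finset.univ_sum_single (LinearMap.pi (fun i => φ.trace ∘ₗ connecting k 𝓔 C (θ i)) h),
    map_sum]
  refine Finset.sum_congr rfl fun i _ => ?_
  rw [← push_pull, ← he]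
  rfl

/-- A submodule of `𝒞(C, Y)` containing the `𝔰`-projective morphisms is separated from each
morphism outside it by the pairing with an extension. -/
lemma exists_trace_pull_ne_zero [IsNoetherianRing k] (hJ : IsInjectiveCogenerator k J)
    (hfin : ∀ Z A : 𝒞, Module.Finite k (𝓔.Ext Z A)) {Y : 𝒞} (N : Submodule k (C ⟶ Y))
    (hN : ∀ h, 𝓔.IsProjMor h → h ∈ N) {g : C ⟶ Y} (hg : g ∉ N) :
    ∃ θ : 𝓔.Ext Y T, (∀ h ∈ N, φ.trace (pull 𝓔.E h θ) = 0) ∧ φ.trace (pull 𝓔.E g θ) ≠ 0 := by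
  have := hJ.finite
  obtain ⟨n, θ, hθ⟩ := φ.exists_generators hJ hfin Y
  let f := LinearMap.pi fun i => φ.trace ∘ₗ connecting k 𝓔 C (θ i)
  have hle : LinearMap.ker f ≤ N := fun h hh => hN h (hθ h hh)
  have : Module.Finite k ((C ⟶ Y) ⧸ LinearMap.ker f) :=
    Module.Finite.equiv f.quotKerEquivRange.symm
  have : Module.Finite k ((C ⟶ Y) ⧸ N) :=
    Module.Finite.of_surjective (Submodule.factor hle) (Submodule.factor_surjective hle)
  obtain ⟨χ, hχ⟩ := hJ.exists_ne_zero (m := N.mkQ g) (by simpa using hg)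
  have hχN : ∀ h ∈ N, (χ ∘ₗ N.mkQ) h = 0 := fun h hh => by
    simp [(Submodule.Quotient.mk_eq_zero N).mpr hh]
  obtain ⟨ε, hε⟩ := φ.exists_eq_trace_pull hJ hfin (χ ∘ₗ N.mkQ) fun h hh => hχN h (hN h hh)
  exact ⟨ε, fun h hh => by rw [← hε, hχN h hh], by rwa [← hε]⟩

/-- A submodule of `𝒞(C, Y)` over `End C` that contains the `𝔰`-projective morphisms is its own
double annihilator with respect to `(h, θ) ↦ h^⋆ θ ∈ 𝔼(C, τC)`. -/
lemma mem_iff_forall_pull_eq_zero [IsNoetherianRing k] (φ : 𝓔.TauIso k J C T)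
    (hJ : IsInjectiveCogenerator k J)
    (hfin : ∀ Z A : 𝒞, Module.Finite k (𝓔.Ext Z A)) {Y : 𝒞}
    (H : Submodule (CategoryTheory.End C)ᵐᵒᵖ (C ⟶ Y))
    (hPH : ∀ f : C ⟶ Y, 𝓔.IsProjMor f → f ∈ H) (g : C ⟶ Y) :
    g ∈ H ↔ ∀ θ : 𝓔.Ext Y T, (∀ h ∈ H, pull 𝓔.E h θ = 0) → pull 𝓔.E g θ = 0 := by
  refine ⟨fun hg θ hθ => hθ g hg, fun hg => ?_⟩
  have hcomp : ∀ (e : C ⟶ C), ∀ h ∈ H, e ≫ h ∈ H := fun e h hh =>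
    H.smul_mem (MulOpposite.op (CategoryTheory.End.of e)) hh
  let N : Submodule k (C ⟶ Y) :=
    { carrier := H
      add_mem' := H.add_mem
      zero_mem' := H.zero_mem
      smul_mem' := fun t h hh => by simpa using hcomp (t • 𝟙 C) h hh }
  by_contra hgH
  obtain ⟨θ, hθN, hθg⟩ := φ.exists_trace_pull_ne_zero hJ hfin N hPH hgH
  refine hθg ?_
  rw [hg θ fun h hh => ?_, map_zero]
  -- The traces of all `e^⋆ h^⋆ θ` vanish because `H` is closed under precomposition.
  exact φ.eq_zero_of_trace_pull_eq_zero hJ hfin _ fun e => by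
    rw [← pull_comp]
    exact hθN _ (hcomp e h hh)

end TauIso

end Extriangulated

end ExtriangulatedAR

/-! ### The triangle of an `End C`-submodule -/

theorem theorem4p5
    {k : Type r} [CommRing k] [IsArtinianRing k]
    {J : Type r} [AddCommGroup J] [Module k J] (hJ : IsMinimalInjectiveCogenerator k J)
    {𝒞 : Type u} [Category.{v} 𝒞] [Preadditive 𝒞] [HasZeroObject 𝒞] [HasBinaryBiproducts 𝒞]
    [HasFiniteBiproducts 𝒞] [Linear k 𝒞]
    (𝓔 : Extriangulated.{v, u, w} 𝒞) [∀ Z A : 𝒞, Module k (𝓔.Ext Z A)] [𝓔.IsLinear k]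
    (hExtFinite : ∀ Z A : 𝒞, Module.Finite k (𝓔.Ext Z A))
    (hKS : IsKrullSchmidt 𝒞)
    (C : 𝒞) (hC : 𝓔.InCr k J C) (τC : 𝒞) (hτC : 𝓔.IsTau k J C τC)
    (Y : 𝒞) (H : Submodule (CategoryTheory.End C)ᵐᵒᵖ (C ⟶ Y))
    (hPH : ∀ f : C ⟶ Y, 𝓔.IsProjMor f → f ∈ H) :
    ∃ (K X : 𝒞) (ι : K ⟶ X) (α : X ⟶ Y) (η : 𝓔.Ext Y K),
      𝓔.IsTriangle ι α η ∧
      IsRightDetermined α C ∧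
      InAdd τC K ∧
      (H : Set (C ⟶ Y)) = Set.range (fun g : C ⟶ X => g ≫ α) := by
  obtain ⟨φ⟩ := hτC
  have hJ' := hJ.toIsInjectiveCogenerator
  have := hExtFinite Y τC
  let Θ : Submodule k (𝓔.Ext Y τC) := ⨅ h ∈ H, LinearMap.ker (Extriangulated.pullₗ k 𝓔 h τC)
  have hΘ : ∀ θ, θ ∈ Θ ↔ ∀ h ∈ H, pull 𝓔.E h θ = 0 := fun θ => by
    simp only [Θ, Submodule.mem_iInf]
    rfl
  obtain ⟨n, θ, hθ⟩ := Submodule.fg_iff_exists_fin_generating_family.mp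
    (IsNoetherian.noetherian Θ)
  let K : 𝒞 := ⨁ fun _ : Fin n => τC
  let η : 𝓔.Ext Y K := ∑ i, push 𝓔.E (biproduct.ι (fun _ : Fin n => τC) i) (θ i)
  have hπ : ∀ j, push 𝓔.E (biproduct.π (fun _ : Fin n => τC) j) η = θ j := by
    intro j
    simp only [η, map_sum, ← push_comp]
    rw [Finset.sum_eq_single j]
    · rw [biproduct.ι_π_self, push_id]
    · intro i _ hij
      rw [biproduct.ι_π_ne _ hij, 𝓔.push_zero_hom]
    · simp
  have hη : ∀ {T : 𝒞} (g : T ⟶ Y), pull 𝓔.E g η = 0 ↔ ∀ i, pull 𝓔.E g (θ i) = 0 := by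
    intro T g
    refine ⟨fun h i => by rw [← hπ, ← push_pull, h, map_zero], fun h => ?_⟩
    simp only [η, map_sum, ← push_pull, h, map_zero, Finset.sum_const_zero]
  obtain ⟨X, ι, α, hα⟩ := 𝓔.exists_isTriangle η
  refine ⟨K, X, ι, α, η, hα, ?_, ?_, ?_⟩
  · intro T g hg
    rw [hα.factors_iff, hη]
    refine fun i => φ.eq_zero_of_trace_pull_eq_zero hJ' hExtFinite _ fun c => ?_
    rw [← pull_comp, (hη _).mp ((hα.factors_iff _).mp (hg c)) i, map_zero]
  · obtain ⟨L, hL⟩ := HasZeroObject.zero (C := 𝒞)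
    exact ⟨n, L, ⟨(isoBiprodZero hL).symm⟩⟩
  · ext g
    rw [Set.mem_range, hα.factors_iff, hη, SetLike.mem_coe,
      φ.mem_iff_forall_pull_eq_zero hJ' hExtFinite H hPH]
    constructor
    · exact fun h i => h _ ((hΘ _).mp (hθ ▸ Submodule.subset_span ⟨i, rfl⟩))
    · intro h ε hε
      have hle : Θ ≤ LinearMap.ker (Extriangulated.pullₗ k 𝓔 g τC) := by
        rw [← hθ, Submodule.span_le]
        rintro _ ⟨i, rfl⟩
        exact h i
      exact hle ((hΘ ε).mpr hε)
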